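/- Let $n\ge 2$ and $q\ge 1$ be integers, let $0\le a<b$, and let $T_0=\{(p,\omega): a\le p\le b,\ a\le\omega\le p\}$. Let $\nu\in C^\infty(T_0)$ be real-valued with $\nu(p,p)\ne 0$ for all $p\in[a,b]$, and put $r(p,\omega)=(p-\omega)^{q/2}\,\nu(p,\omega)$ on $T_0$. Let $L^2_c(\{a\le x_n\le b\})$ be the space of (complex-valued) square integrable functions on $\mathbb{R}^n=\mathbb{R}^{n-1}\times\mathbb{R}$ that vanish almost everywhere outside a compact subset of $\{a\le x_n\le b\}$. For such $f$ define $$\mathcal{R}f(p,\mathbf{y})=\int_{S^{n-2}}\int_a^p\sqrt{1+\Big(\frac{\partial r}{\partial\omega}(p,\omega)\Big)^2}\;r(p,\omega)^{n-2}\,f\big(r(p,\omega)\Theta+\mathbf{y},\,\omega\big)\,\mathrm{d}\omega\,\mathrm{d}S^{n-2}(\Theta),\qquad p\in[a,b],\ \mathbf{y}\in\mathbb{R}^{n-1},$$ where $\mathrm{d}S^{n-2}$ is the surface measure on the unit sphere $S^{n-2}\subset\mathbb{R}^{n-1}$ (for $n=2$, the sum over $\Theta=\pm1$). Then, for almost every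 $p\in[a,b]$ and almost every $\mathbf{y}\in\mathbb{R}^{n-1}$, the integrand is integrable on $S^{n-2}\times[a,p]$, and for $f,g\in L^2_c(\{a\le x_n\le b\})$, $$\mathcal{R}f(p,\mathbf{y})=\mathcal{R}g(p,\mathbf{y})\ \text{ for almost every } p\in[a,b] \text{ and almost every } \mathbf{y}\in\mathbb{R}^{n-1}\iff f=g\ \text{ almost everywhere}.$$ In particular, $f$ is uniquely determined by $\mathcal{R}f(p,\mathbf{y})$ for $\mathbf{y}\in\mathbb{R}^{n-1}$ and $p\in[a,b]$. -/

import Mathlib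

open MeasureTheory Set
open scoped ContDiff

/-- `ℝ^{n-1}`. Points of `ℝⁿ` are written `(x', xₙ)` with `x' ∈ ℝ^{n-1}` and `xₙ ∈ ℝ`, so that
`ℝⁿ` is `Horiz n × ℝ` with the product Lebesgue measure. -/
abbrev Horiz (n : ℕ) : Type := EuclideanSpace ℝ (Fin (n - 1))

/-- The unit sphere `S^{n-2}` of `ℝ^{n-1}`; for `n = 2` it consists of two points. -/
abbrev UnitSphere (n : ℕ) : Type := Metric.sphere (0 : Horiz n) 1

/-- Surface measure on `S^{n-2}`; for `n = 2` it gives mass one to each of the two points. -/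
noncomputable def surfaceMeasure (n : ℕ) : Measure (UnitSphere n) :=
  (volume : Measure (Horiz n)).toSphere

/-- The closed triangle `T₀ = {(p, w) : a ≤ p ≤ b, a ≤ w ≤ p}`. -/
def triangle (a b : ℝ) : Set (ℝ × ℝ) :=
  {z | a ≤ z.1 ∧ z.1 ≤ b ∧ a ≤ z.2 ∧ z.2 ≤ z.1}

/-- `f ∈ L²_c({a ≤ xₙ ≤ b})`: square integrable, and zero almost everywhere outside
a compact subset of the slab. -/
def MemL2c (n : ℕ) (a b : ℝ) (f : Horiz n × ℝ → ℂ) : Prop :=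
  MemLp f 2 volume ∧
    ∃ K : Set (Horiz n × ℝ), IsCompact K ∧ K ⊆ {x | a ≤ x.2 ∧ x.2 ≤ b} ∧
      ∀ᵐ x, x ∉ K → f x = 0

/-- The integrand `√(1 + (dr/dw)²) r(p,w)^{n-2} f(r(p,w) Θ + y, w)` of the transform. -/
noncomputable def radonIntegrand (n : ℕ) (r : ℝ → ℝ → ℝ) (f : Horiz n × ℝ → ℂ)
    (p : ℝ) (y : Horiz n) (Θ : UnitSphere n) (w : ℝ) : ℂ :=
  ((Real.sqrt (1 + (deriv (fun t => r p t) w) ^ 2) * r p w ^ (n - 2) : ℝ) : ℂ) *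
    f (r p w • (Θ : Horiz n) + y, w)

/-- The generalized Radon transform
`Rf(p,y) = ∫_{S^{n-2}} ∫_a^p √(1 + (dr/dw)²) r(p,w)^{n-2} f(r(p,w) Θ + y, w) dw dΘ`. -/
noncomputable def genRadon (n : ℕ) (a : ℝ) (r : ℝ → ℝ → ℝ) (f : Horiz n × ℝ → ℂ)
    (p : ℝ) (y : Horiz n) : ℂ :=
  ∫ Θ : UnitSphere n, ∫ w in Icc a p, radonIntegrand n r f p y Θ w ∂volume ∂(surfaceMeasure n)

/-! By linearity, let `h = f - g` have vanishing transform. Integrate the transform at fixed `p`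
against `⟨y, ξ⟩ ^ m` over `y`. The translation `x = y + r Θ` turns this into `(⟨x, ξ⟩ - r ⟨Θ, ξ⟩) ^
m`, and the binomial expansion involves only the horizontal moments `φ_j(w) = ∫ ⟨x, ξ⟩ ^ j h(x, w)
dx` with `j ≤ m`. By strong induction those with `j < m` vanish, and what remains is a scalar
equation `∫ w in a..p, k(p, w) φ_m(w) = 0` (`ae_moment_eq_zero`). Of the sphere, only its finite
nonzero measure and the boundedness of the displacement matter.

The kernel is `(p - w) ^ β * M(p, w)` with `β > -1` and `M` smooth and nonzero on the diagonal
(`exists_weight_factorization`): a generalized Abel equation. Integrating it against `(s - p) ^ γ`,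
with `γ + β` a natural number, makes the power of `s - w` integral. Repeated differentiation then
gives a Volterra equation of the second kind, and Gronwall's inequality forces `φ_m = 0`
(`ae_eq_zero_of_abel`).

Since `h` has compact support, its Fourier transform is a power series in the horizontal frequency,
with coefficients built from these moments. It vanishes, hence `h = 0`
(`ae_eq_zero_of_moment_eq_zero`). Conversely, changing `f` on a null set changes the transform only
for a null set of `y`, for each `p`. -/

/-! ### Volterra equations with integrable solutions -/

section Volterra

/-- Gronwall's inequality for integrable functions. -/
theorem ae_eq_zero_of_norm_le_setIntegral {F : Type*} [NormedAddCommGroup F] {a b : ℝ} {φ : ℝ → F} (hφ : Integrable φ) {C : ℝ}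
    (h : ∀ᵐ t ∂(volume.restrict (Icc a b)), ‖φ t‖ ≤ C * ∫ w in Icc a t, ‖φ w‖) :
    ∀ᵐ t ∂(volume.restrict (Icc a b)), φ t = 0 := by
  set Φ : ℝ → ℝ := fun t => ∫ w in a..t, ‖φ w‖ with hΦ
  have hΦc : Continuous Φ :=
    intervalIntegral.continuous_primitive (fun _ _ => hφ.norm.intervalIntegrable) a
  -- `Φ` need not be differentiable everywhere, so Gronwall is applied to its primitive `Y`, which
  -- satisfies `Y' = Φ ≤ C * Y` at every point of `[a, b]`.
  set Y : ℝ → ℝ := fun t => ∫ w in a..t, Φ w with hY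
  have hYd : ∀ t, HasDerivAt Y (Φ t) t := fun t => hΦc.integral_hasStrictDerivAt a t |>.hasDerivAt
  have hIcc : ∀ t ∈ Icc a b, ∫ w in Icc a t, ‖φ w‖ = Φ t := fun t ht => by
    rw [hΦ]; simp only
    rw [intervalIntegral.integral_of_le ht.1, integral_Icc_eq_integral_Ioc]
  have hΦ0 : ∀ t ∈ Icc a b, 0 ≤ Φ t := fun t ht => by
    rw [← hIcc t ht]; exact integral_nonneg fun _ => norm_nonneg _
  have hY0 : ∀ t ∈ Icc a b, 0 ≤ Y t := fun t ht =>
    intervalIntegral.integral_nonneg ht.1 fun u hu => hΦ0 u ⟨hu.1, hu.2.trans ht.2⟩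
  have hle : ∀ t ∈ Icc a b, Φ t ≤ C * Y t := by
    intro t ht
    rw [hY]; simp only
    rw [← intervalIntegral.integral_const_mul, hΦ]
    simp only
    rw [intervalIntegral.integral_of_le ht.1, intervalIntegral.integral_of_le ht.1,
      ← integral_Icc_eq_integral_Ioc, ← integral_Icc_eq_integral_Ioc]
    refine integral_mono_ae hφ.norm.integrableOn
      ((continuous_const.mul hΦc).integrableOn_Icc) ?_
    have := ae_restrict_of_ae_restrict_of_subset (Icc_subset_Icc_right ht.2) h
    filter_upwards [this, ae_restrict_mem measurableSet_Icc] with u hu hu'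
    rwa [hIcc u ⟨hu'.1, hu'.2.trans ht.2⟩] at hu
  have hYz : ∀ t ∈ Icc a b, Y t = 0 := by
    intro t ht
    have := norm_le_gronwallBound_of_norm_deriv_right_le (f := Y) (f' := Φ) (δ := 0) (K := C) (ε := 0)
      (a := a) (b := b) (fun t _ => (hYd t).continuousAt.continuousWithinAt)
      (fun t _ => (hYd t).hasDerivWithinAt) (by simp [hY]) (fun t ht => by
        have ht' : t ∈ Icc a b := Ico_subset_Icc_self ht
        rw [Real.norm_of_nonneg (hΦ0 t ht'), Real.norm_of_nonneg (hY0 t ht'), add_zero]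
        exact hle t ht') t ht
    simpa [gronwallBound_ε0] using this
  filter_upwards [h, ae_restrict_mem measurableSet_Icc] with t ht ht'
  have h1 : Φ t = 0 := le_antisymm ((hle t ht').trans (by simp [hYz t ht'])) (hΦ0 t ht')
  rw [hIcc t ht', h1, mul_zero] at ht
  exact norm_le_zero_iff.1 ht

variable {E : Type*} [NormedAddCommGroup E] [NormedSpace ℝ E] {a b : ℝ}

theorem mem_triangle {p w : ℝ} :
    (p, w) ∈ triangle a b ↔ a ≤ p ∧ p ≤ b ∧ a ≤ w ∧ w ≤ p := Iff.rfl

theorem isCompact_triangle : IsCompact (triangle a b) := by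
  refine (isCompact_Icc.prod isCompact_Icc : IsCompact (Icc a b ×ˢ Icc a b)).of_isClosed_subset ?_ ?_
  · have h : triangle a b = {z : ℝ × ℝ | a ≤ z.1} ∩ ({z | z.1 ≤ b} ∩ ({z | a ≤ z.2} ∩ {z | z.2 ≤ z.1})) := by
      ext z; simp [triangle]
    rw [h]
    exact (isClosed_le continuous_const continuous_fst).inter
      ((isClosed_le continuous_fst continuous_const).inter
        ((isClosed_le continuous_const continuous_snd).inter
          (isClosed_le continuous_snd continuous_fst)))
  · rintro ⟨p, w⟩ ⟨h1, h2, h3, h4⟩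
    exact ⟨⟨h1, h2⟩, h3, h4.trans h2⟩

theorem measurableSet_triangle : MeasurableSet (triangle a b) :=
  isCompact_triangle.isClosed.measurableSet

/-- A continuous function on the triangle times `(p - w) ^ β`, `β > -1`, times an integrable function
of `w` is integrable on the triangle. -/
theorem integrable_indicator_triangle {β : ℝ} (hβ : -1 < β) {M : ℝ → ℝ → ℝ}
    (hM : ContinuousOn (fun z : ℝ × ℝ => M z.1 z.2) (triangle a b)) {φ : ℝ → E}
    (hφ : Integrable φ) :
    Integrable ((triangle a b).indicator
      fun z : ℝ × ℝ => ((z.1 - z.2) ^ β * M z.1 z.2) • φ z.2) (volume.prod volume) := by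
  by_cases hab : a ≤ b
  swap
  · have : triangle a b = ∅ := by
      ext ⟨p, w⟩; simp only [mem_triangle, mem_empty_iff_false, iff_false]; rintro ⟨h1, h2, -⟩
      exact hab (h1.trans h2)
    simp [this]
  obtain ⟨C, hC⟩ := isCompact_triangle.exists_bound_of_continuousOn hM
  have hκ : Integrable ((Icc 0 (b - a)).indicator fun u : ℝ => u ^ β) := by
    rw [integrable_indicator_iff measurableSet_Icc, integrableOn_Icc_iff_integrableOn_Ioc,
      ← intervalIntegrable_iff_integrableOn_Ioc_of_le (by linarith)]
    exact intervalIntegral.intervalIntegrable_rpow' hβ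
  -- Up to the bounded factor `M`, the integrand is that of the convolution of `φ` with the
  -- truncated power `u ^ β`, both integrable.
  have hconv := hφ.convolution_integrand (ContinuousLinearMap.lsmul ℝ ℝ).flip hκ
  have hMs : AEStronglyMeasurable ((triangle a b).indicator fun z : ℝ × ℝ => M z.1 z.2)
      (volume.prod volume) :=
    (aestronglyMeasurable_indicator_iff measurableSet_triangle).2
      (hM.aestronglyMeasurable measurableSet_triangle)
  refine (hconv.bdd_smul (φ := (triangle a b).indicator fun z : ℝ × ℝ => M z.1 z.2) C
    hMs ?_).congr ?_
  · refine .of_forall fun z => ?_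
    by_cases hz : z ∈ triangle a b
    · simpa [hz] using hC z hz
    · simpa [hz] using (norm_nonneg _).trans (hC (a, a) ⟨le_rfl, hab, le_rfl, le_rfl⟩)
  · refine .of_forall fun z => ?_
    by_cases hz : z ∈ triangle a b
    · have : z.1 - z.2 ∈ Icc 0 (b - a) := by
        obtain ⟨h1, h2, h3, h4⟩ := hz
        constructor <;> linarith
      simp [hz, this, smul_smul, mul_comm]
    · simp [hz]

theorem integral_indicator_triangle {F : ℝ → ℝ → E} {p : ℝ} (hp : p ∈ Icc a b) :
    ∫ w, (triangle a b).indicator (fun z : ℝ × ℝ => F z.1 z.2) (p, w) = ∫ w in Icc a p, F p w := by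
  rw [← integral_indicator measurableSet_Icc]
  refine integral_congr_ae (.of_forall fun w => ?_)
  by_cases hw : w ∈ Icc a p
  · have : (p, w) ∈ triangle a b := ⟨hp.1, hp.2, hw.1, hw.2⟩
    simp [hw, this]
  · have : (p, w) ∉ triangle a b := fun h => hw ⟨h.2.2.1, h.2.2.2⟩
    simp [hw, this]

/-- Fubini on the triangle, against a bounded function of the outer variable. -/
theorem integral_triangle_swap {F : ℝ → ℝ → E}
    (hF : Integrable ((triangle a b).indicator fun z : ℝ × ℝ => F z.1 z.2) (volume.prod volume))
    {s C : ℝ} (hs : s ∈ Icc a b) {g : ℝ → ℝ} (hg : ContinuousOn g (Icc a s))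
    (hgC : ∀ t ∈ Icc a s, |g t| ≤ C) :
    ∫ t in Icc a s, g t • ∫ w in Icc a t, F t w
      = ∫ w in Icc a s, ∫ t in Icc w s, g t • F t w := by
  set Ψ : ℝ × ℝ → E := (triangle a b).indicator fun z : ℝ × ℝ => F z.1 z.2 with hΨ
  have hint : Integrable (fun z : ℝ × ℝ => g z.1 • Ψ z) ((volume.restrict (Icc a s)).prod volume) := by
    refine (hF.mono_measure (Measure.prod_mono Measure.restrict_le_self le_rfl)).bdd_smul C ?_ ?_
    · exact (hg.aestronglyMeasurable measurableSet_Icc).comp_fst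
    · have := (ae_restrict_mem (μ := volume) (measurableSet_Icc (a := a) (b := s)))
      filter_upwards [Measure.quasiMeasurePreserving_fst.ae this] with z hz
      exact hgC _ hz
  calc
    _ = ∫ t in Icc a s, ∫ w, g t • Ψ (t, w) := by
      refine setIntegral_congr_fun measurableSet_Icc fun t ht => ?_
      have ht' : t ∈ Icc a b := ⟨ht.1, ht.2.trans hs.2⟩
      simp only [integral_smul]
      rw [hΨ, integral_indicator_triangle ht']
    _ = ∫ w, ∫ t in Icc a s, g t • Ψ (t, w) := integral_integral_swap hint
    _ = _ := by
      rw [← integral_indicator measurableSet_Icc]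
      refine integral_congr_ae (.of_forall fun w => ?_)
      by_cases hw : w ∈ Icc a s
      · simp only [hw, indicator_of_mem]
        have hsub : Icc w s ⊆ Icc a s := Icc_subset_Icc_left hw.1
        rw [setIntegral_eq_of_subset_of_forall_sdiff_eq_zero measurableSet_Icc hsub]
        · refine setIntegral_congr_fun measurableSet_Icc fun t ht => ?_
          have : (t, w) ∈ triangle a b := ⟨hw.1.trans ht.1, ht.2.trans hs.2, hw.1, ht.1⟩
          simp [hΨ, this]
        · rintro t ⟨ht, ht'⟩
          have : (t, w) ∉ triangle a b := fun h => ht' ⟨h.2.2.2, ht.2⟩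
          simp [hΨ, this]
      · simp only [hw, not_false_eq_true, indicator_of_notMem]
        rw [setIntegral_congr_fun (g := fun _ => (0 : E)) measurableSet_Icc, integral_zero]
        intro t ht
        have : (t, w) ∉ triangle a b := fun h => hw ⟨h.2.2.1, h.2.2.2.trans ht.2⟩
        simp [hΨ, this]

variable [CompleteSpace E]

/-- The primitive is continuous, so vanishing almost everywhere on `[a, b]` means vanishing
identically there; Lebesgue differentiation recovers `g`. -/
theorem ae_eq_zero_of_ae_setIntegral_Icc_eq_zero (hab : a < b) {g : ℝ → E} (hg : Integrable g)
    (h : ∀ᵐ s ∂(volume.restrict (Icc a b)), ∫ t in Icc a s, g t = 0) :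
    ∀ᵐ t ∂(volume.restrict (Icc a b)), g t = 0 := by
  have hcont : Continuous fun s => ∫ t in a..s, g t :=
    intervalIntegral.continuous_primitive (fun _ _ => hg.intervalIntegrable) a
  have h0 : EqOn (fun s => ∫ t in a..s, g t) (fun _ => 0) (Icc a b) := by
    refine Measure.eqOn_Icc_of_ae_eq volume hab.ne ?_ hcont.continuousOn continuousOn_const
    filter_upwards [h, ae_restrict_mem measurableSet_Icc] with s hs hs'
    rw [intervalIntegral.integral_of_le hs'.1, ← integral_Icc_eq_integral_Ioc, hs]
  rw [← restrict_Ioo_eq_restrict_Icc]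
  filter_upwards [ae_restrict_mem measurableSet_Ioo,
    ae_restrict_of_ae (LocallyIntegrable.ae_hasDerivAt_integral hg.locallyIntegrable)] with t ht hd
  have h1 := hd a
  have h2 : HasDerivAt (fun s => ∫ t in a..s, g t) 0 t := by
    refine (hasDerivAt_const t (0 : E)).congr_of_eventuallyEq ?_
    filter_upwards [Ioo_mem_nhds ht.1 ht.2] with s hs
    exact h0 (Ioo_subset_Icc_self hs)
  exact h1.unique h2

/-- Differentiation of a Volterra equation of the first kind. -/
theorem volterra_differentiate (hab : a < b) {H H' : ℝ → ℝ → ℝ}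
    (hH : ContinuousOn (fun z : ℝ × ℝ => H z.1 z.2) (triangle a b))
    (hH' : ContinuousOn (fun z : ℝ × ℝ => H' z.1 z.2) (triangle a b))
    (hd : ∀ w s, a ≤ w → w < s → s < b → HasDerivAt (fun s => H s w) (H' s w) s)
    {φ : ℝ → E} (hφ : Integrable φ)
    (h : ∀ᵐ s ∂(volume.restrict (Icc a b)), ∫ w in Icc a s, H s w • φ w = 0) :
    ∀ᵐ t ∂(volume.restrict (Icc a b)), H t t • φ t + ∫ w in Icc a t, H' t w • φ w = 0 := by
  have hΨ : Integrable ((triangle a b).indicator fun z : ℝ × ℝ => H' z.1 z.2 • φ z.2)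
      (volume.prod volume) := by
    simpa using integrable_indicator_triangle (β := 0) (by norm_num) hH' hφ
  have hdiagc : ContinuousOn (fun t => H t t) (Icc a b) :=
    hH.comp (f := fun t : ℝ => (t, t)) (by fun_prop) fun t ht => ⟨ht.1, ht.2, ht.1, le_rfl⟩
  obtain ⟨C, hC⟩ := isCompact_Icc.exists_bound_of_continuousOn hdiagc
  have hdiag : IntegrableOn (fun t => H t t • φ t) (Icc a b) := by
    refine hφ.integrableOn.bdd_smul C (hdiagc.aestronglyMeasurable measurableSet_Icc) ?_
    filter_upwards [ae_restrict_mem measurableSet_Icc] with t ht using hC t ht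
  -- The solution `φ` is only integrable, so the equation is not differentiated directly. Its formal
  -- derivative `g` is integrated over `[a, s]` instead: Fubini and the fundamental theorem of
  -- calculus in `t` return the original equation.
  set g : ℝ → E := fun t => (Icc a b).indicator (fun t => H t t • φ t) t +
    ∫ w, (triangle a b).indicator (fun z : ℝ × ℝ => H' z.1 z.2 • φ z.2) (t, w) with hgdef
  have hg : Integrable g :=
    ((integrable_indicator_iff measurableSet_Icc).2 hdiag).add hΨ.integral_prod_left
  have hgv : ∀ t ∈ Icc a b, g t = H t t • φ t + ∫ w in Icc a t, H' t w • φ w := by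
    intro t ht
    simp only [hgdef, ht, indicator_of_mem]
    rw [integral_indicator_triangle (F := fun t w => H' t w • φ w) ht]
  have hz := ae_eq_zero_of_ae_setIntegral_Icc_eq_zero hab hg ?_
  · filter_upwards [hz, ae_restrict_mem measurableSet_Icc] with t ht ht'
    rw [← hgv t ht', ht]
  filter_upwards [h, ae_restrict_mem measurableSet_Icc] with s hs hs'
  rw [← hs]
  have hsub : Icc a s ⊆ Icc a b := Icc_subset_Icc_right hs'.2
  have hi2 : IntegrableOn (fun t => ∫ w in Icc a t, H' t w • φ w) (Icc a s) := by
    refine (hΨ.integral_prod_left.integrableOn (s := Icc a s)).congr_fun (fun t ht => ?_) measurableSet_Icc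
    exact integral_indicator_triangle (F := fun t w => H' t w • φ w) (hsub ht)
  have hsw := integral_triangle_swap (F := fun t w => H' t w • φ w) hΨ hs' (g := fun _ => 1) (C := 1)
    continuousOn_const (by simp)
  simp only [one_smul] at hsw
  have hFTC : ∀ w ∈ Icc a s, ∫ t in Icc w s, H' t w • φ w = (H s w - H w w) • φ w := by
    intro w hw
    rw [integral_smul_const, integral_Icc_eq_integral_Ioc, ← intervalIntegral.integral_of_le hw.2]
    congr 1
    have hmap : ∀ t ∈ Icc w s, (t, w) ∈ triangle a b := fun t ht =>
      ⟨hw.1.trans ht.1, ht.2.trans hs'.2, hw.1, ht.1⟩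
    have hc : ContinuousOn (fun t => H t w) (Icc w s) :=
      hH.comp (f := fun t : ℝ => (t, w)) (by fun_prop) hmap
    have hc' : ContinuousOn (fun t => H' t w) (Icc w s) :=
      hH'.comp (f := fun t : ℝ => (t, w)) (by fun_prop) hmap
    exact intervalIntegral.integral_eq_sub_of_hasDerivAt_of_le hw.2 hc
      (fun t ht => hd w t hw.1 ht.1 (ht.2.trans_le hs'.2))
      (hc'.intervalIntegrable_of_Icc hw.2)
  have hmap : ∀ w ∈ Icc a s, (s, w) ∈ triangle a b := fun w hw => ⟨hs'.1, hs'.2, hw.1, hw.2⟩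
  have hi3 : IntegrableOn (fun w => H s w • φ w) (Icc a s) := by
    have hc : ContinuousOn (fun w => H s w) (Icc a s) :=
      hH.comp (f := fun t : ℝ => (s, t)) (by fun_prop) hmap
    obtain ⟨C, hC⟩ := isCompact_Icc.exists_bound_of_continuousOn hc
    refine hφ.integrableOn.bdd_smul C (hc.aestronglyMeasurable measurableSet_Icc) ?_
    filter_upwards [ae_restrict_mem measurableSet_Icc] with t ht using hC t ht
  calc
    _ = ∫ t in Icc a s, (H t t • φ t + ∫ w in Icc a t, H' t w • φ w) :=
      setIntegral_congr_fun measurableSet_Icc fun t ht => hgv t (hsub ht)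
    _ = (∫ t in Icc a s, H t t • φ t) + ∫ w in Icc a s, (H s w - H w w) • φ w := by
      rw [integral_add (hdiag.mono_set hsub) hi2, hsw]
      congr 1
      exact setIntegral_congr_fun measurableSet_Icc hFTC
    _ = _ := by
      simp only [sub_smul]
      rw [integral_sub hi3 (hdiag.mono_set hsub)]
      abel

end Volterra

/-! ### Reduction of generalized Abel equations to Volterra equations -/

section Abel

variable {a b : ℝ}

/-- `F` is continuous on the triangle, together with its first `k` partial derivatives
in the first variable. -/
def ContPartials (a b : ℝ) : ℕ → (ℝ → ℝ → ℝ) → Prop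
  | 0, F => ContinuousOn (fun z : ℝ × ℝ => F z.1 z.2) (triangle a b)
  | k + 1, F => ContinuousOn (fun z : ℝ × ℝ => F z.1 z.2) (triangle a b) ∧
      ∃ F' : ℝ → ℝ → ℝ, ContPartials a b k F' ∧
        ∀ w s, a ≤ w → w < s → s < b → HasDerivAt (fun s => F s w) (F' s w) s

namespace ContPartials

theorem continuousOn {k : ℕ} {F : ℝ → ℝ → ℝ} (h : ContPartials a b k F) :
    ContinuousOn (fun z : ℝ × ℝ => F z.1 z.2) (triangle a b) := by
  cases k with
  | zero => exact h
  | succ k => exact h.1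

theorem of_succ {k : ℕ} {F : ℝ → ℝ → ℝ} (h : ContPartials a b (k + 1) F) :
    ContPartials a b k F := by
  induction k generalizing F with
  | zero => exact h.1
  | succ k ih =>
    obtain ⟨h1, F', hF', hd⟩ := h
    exact ⟨h1, F', ih hF', hd⟩

theorem const_mul {k : ℕ} {F : ℝ → ℝ → ℝ} (h : ContPartials a b k F) (c : ℝ) :
    ContPartials a b k fun s w => c * F s w := by
  induction k generalizing F with
  | zero => exact ContinuousOn.mul continuousOn_const h
  | succ k ih =>
    obtain ⟨h1, F', hF', hd⟩ := h
    exact ⟨continuousOn_const.mul h1, _, ih hF', fun w s h1 h2 h3 => (hd w s h1 h2 h3).const_mul c⟩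

theorem add {k : ℕ} {F G : ℝ → ℝ → ℝ} (hF : ContPartials a b k F) (hG : ContPartials a b k G) :
    ContPartials a b k fun s w => F s w + G s w := by
  induction k generalizing F G with
  | zero => exact ContinuousOn.add hF hG
  | succ k ih =>
    obtain ⟨h1, F', hF', hd⟩ := hF
    obtain ⟨h1', G', hG', hd'⟩ := hG
    exact ⟨h1.add h1', _, ih hF' hG',
      fun w s h1 h2 h3 => (hd w s h1 h2 h3).add (hd' w s h1 h2 h3)⟩

theorem sub_mul {k : ℕ} {F : ℝ → ℝ → ℝ} (h : ContPartials a b k F) :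
    ContPartials a b k fun s w => (s - w) * F s w := by
  induction k generalizing F with
  | zero => exact ContinuousOn.mul (by fun_prop) h
  | succ k ih =>
    have hF := h.of_succ
    obtain ⟨h1, F', hF', hd⟩ := h
    refine ⟨ContinuousOn.mul (by fun_prop) h1, _, hF.add (ih hF'), fun w s h1 h2 h3 => ?_⟩
    convert! ((hasDerivAt_id s).sub_const w).mul (hd w s h1 h2 h3) using 1
    simp

end ContPartials

theorem uniqueDiffOn_triangle (hab : a < b) : UniqueDiffOn ℝ (triangle a b) := by
  refine uniqueDiffOn_convex ?_ ?_
  · have h : triangle a b = {z : ℝ × ℝ | a ≤ z.1} ∩ ({z | z.1 ≤ b} ∩ ({z | a ≤ z.2} ∩ {z | z.2 - z.1 ≤ 0})) := by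
      ext z; simp [triangle]
    rw [h]
    exact (convex_halfSpace_ge (LinearMap.fst ℝ ℝ ℝ).isLinear a).inter
      ((convex_halfSpace_le (LinearMap.fst ℝ ℝ ℝ).isLinear b).inter
        ((convex_halfSpace_ge (LinearMap.snd ℝ ℝ ℝ).isLinear a).inter
          (convex_halfSpace_le (LinearMap.snd ℝ ℝ ℝ - LinearMap.fst ℝ ℝ ℝ).isLinear 0)))
  · refine ⟨(a + 2 / 3 * (b - a), a + 1 / 3 * (b - a)), mem_interior.2
      ⟨{z : ℝ × ℝ | z.1 < b} ∩ ({z | a < z.2} ∩ {z | z.2 < z.1}), ?_, ?_, ?_⟩⟩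
    · rintro ⟨p, w⟩ ⟨h1, h2, h3⟩
      simp only [mem_ofPred_eq] at h1 h2 h3
      exact ⟨by dsimp only; linarith, h1.le, h2.le, h3.le⟩
    · exact (isOpen_lt continuous_fst continuous_const).inter
        ((isOpen_lt continuous_const continuous_snd).inter
          (isOpen_lt continuous_snd continuous_fst))
    · refine ⟨?_, ?_, ?_⟩ <;> simp only [mem_ofPred_eq] <;> linarith

theorem ContDiffOn.contPartials (hab : a < b) {F : ℝ → ℝ → ℝ}
    (hF : ContDiffOn ℝ ∞ (fun z : ℝ × ℝ => F z.1 z.2) (triangle a b)) (k : ℕ) :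
    ContPartials a b k F := by
  induction k generalizing F with
  | zero => exact hF.continuousOn
  | succ k ih =>
    have hU := uniqueDiffOn_triangle hab
    refine ⟨hF.continuousOn, fun s w => fderivWithin ℝ (fun z : ℝ × ℝ => F z.1 z.2) (triangle a b)
      (s, w) (1, 0), ih ?_, fun w s h1 h2 h3 => ?_⟩
    · exact (hF.fderivWithin hU (m := ∞) (by simp)).clm_apply contDiffOn_const
    · have hT : (s, w) ∈ triangle a b := ⟨h1.trans h2.le, h3.le, h1, h2.le⟩
      have hd := ((hF.differentiableOn (by simp)) (s, w) hT).hasFDerivWithinAt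
      -- Only the line `w = const` is used: it stays in the triangle on `[w, b]`, and `s` is
      -- interior to that interval even when `w = a`.
      have hl : HasDerivWithinAt (fun t : ℝ => (t, w)) (1, 0) (Icc w b) s :=
        (hasDerivWithinAt_id s _).prodMk (hasDerivWithinAt_const s _ w)
      exact (hd.comp_hasDerivWithinAt (f := fun t : ℝ => (t, w)) s hl (fun t ht =>
        ⟨h1.trans ht.1, ht.2, h1, ht.1⟩)).hasDerivAt (Icc_mem_nhds h2 h3)

variable {E : Type*} [NormedAddCommGroup E] [NormedSpace ℝ E]

/-- A Volterra equation of the second kind with bounded kernel has no nonzero solution. -/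
theorem ae_eq_zero_of_volterra_second_kind (hab : a ≤ b) {d : ℝ → ℝ} {H : ℝ → ℝ → ℝ}
    (hd : ContinuousOn d (Icc a b)) (hd0 : ∀ t ∈ Icc a b, d t ≠ 0)
    (hH : ContinuousOn (fun z : ℝ × ℝ => H z.1 z.2) (triangle a b))
    {φ : ℝ → E} (hφ : Integrable φ)
    (h : ∀ᵐ t ∂(volume.restrict (Icc a b)), d t • φ t + ∫ w in Icc a t, H t w • φ w = 0) :
    ∀ᵐ t ∂(volume.restrict (Icc a b)), φ t = 0 := by
  obtain ⟨C, hC⟩ := isCompact_triangle.exists_bound_of_continuousOn hH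
  obtain ⟨D, hD⟩ := isCompact_Icc.exists_bound_of_continuousOn (hd.inv₀ hd0)
  have hD0 : 0 ≤ D := (norm_nonneg _).trans (hD a ⟨le_rfl, hab⟩)
  refine ae_eq_zero_of_norm_le_setIntegral hφ (C := D * C) ?_
  filter_upwards [h, ae_restrict_mem measurableSet_Icc] with t ht ht'
  have h1 : φ t = -((d t)⁻¹ • ∫ w in Icc a t, H t w • φ w) := by
    rw [← smul_neg, ← eq_neg_of_add_eq_zero_left ht, smul_smul, inv_mul_cancel₀ (hd0 t ht'), one_smul]
  have h2 : ‖∫ w in Icc a t, H t w • φ w‖ ≤ ∫ w in Icc a t, C * ‖φ w‖ := by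
    refine norm_integral_le_of_norm_le (hφ.norm.integrableOn.const_mul C) ?_
    filter_upwards [ae_restrict_mem measurableSet_Icc] with w hw
    rw [norm_smul]
    gcongr
    exact hC (t, w) ⟨ht'.1, ht'.2, hw.1, hw.2⟩
  rw [integral_const_mul] at h2
  calc ‖φ t‖ = ‖(d t)⁻¹‖ * ‖∫ w in Icc a t, H t w • φ w‖ := by
        nth_rewrite 1 [h1]; rw [norm_neg, norm_smul]
    _ ≤ D * (C * ∫ w in Icc a t, ‖φ w‖) :=
      mul_le_mul (hD t ht') h2 (norm_nonneg _) hD0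
    _ = _ := by ring

variable [CompleteSpace E]

/-- While the power of `s - w` is positive, the diagonal term of the differentiated equation
vanishes and the power drops by one. The new factor `(N + 1) * L + (s - w) * L'` has one derivative
fewer and diagonal `(N + 1) * L t t ≠ 0`. At power zero the diagonal term survives and the equation
is of the second kind. -/
theorem ae_eq_zero_of_volterra_pow (hab : a < b) {φ : ℝ → E} (hφ : Integrable φ) {N : ℕ}
    {L : ℝ → ℝ → ℝ} (hL : ContPartials a b (N + 1) L) (hdiag : ∀ t ∈ Icc a b, L t t ≠ 0)
    (h : ∀ᵐ s ∂(volume.restrict (Icc a b)), ∫ w in Icc a s, ((s - w) ^ N * L s w) • φ w = 0) :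
    ∀ᵐ t ∂(volume.restrict (Icc a b)), φ t = 0 := by
  induction N generalizing L with
  | zero =>
    obtain ⟨hc, L', hL', hd⟩ := hL
    simp only [pow_zero, one_mul] at h
    exact ae_eq_zero_of_volterra_second_kind hab.le
      (hc.comp (f := fun t : ℝ => (t, t)) (by fun_prop) fun t ht => ⟨ht.1, ht.2, ht.1, le_rfl⟩)
      hdiag hL'.continuousOn hφ (volterra_differentiate hab hc hL'.continuousOn hd hφ h)
  | succ N ih =>
    have hL1 := hL.of_succ
    obtain ⟨hc, L', hL', hd⟩ := hL
    refine ih ((hL1.const_mul (N + 1)).add hL'.sub_mul) (fun t ht => ?_) ?_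
    · simpa using ⟨by positivity, hdiag t ht⟩
    · have := volterra_differentiate hab (H := fun s w => (s - w) ^ (N + 1) * L s w)
        (H' := fun s w => (s - w) ^ N * ((N + 1) * L s w + (s - w) * L' s w))
        (ContinuousOn.mul (by fun_prop) hc)
        (ContinuousOn.mul (by fun_prop) ((hL1.const_mul (N + 1)).add hL'.sub_mul).continuousOn)
        (fun w s h1 h2 h3 => ?_) hφ h
      · simpa using this
      · convert! (((hasDerivAt_id s).sub_const w).pow (N + 1)).mul (hd w s h1 h2 h3) using 1
        simp
        ring

/-- Weighted average of `F(·, w)` over the segment from `w` to `s`. -/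
noncomputable def segmentAverage (κ : ℝ → ℝ) (F : ℝ → ℝ → ℝ) (s w : ℝ) : ℝ :=
  ∫ t in Ioc (0 : ℝ) 1, κ t * F (w + t * (s - w)) w

theorem segment_mem_triangle {s w t : ℝ} (h : (s, w) ∈ triangle a b) (ht : t ∈ Ioc (0 : ℝ) 1) :
    (w + t * (s - w), w) ∈ triangle a b := by
  obtain ⟨h1, h2, h3, h4⟩ := h
  simp only at h1 h2 h3 h4
  have := mul_nonneg ht.1.le (sub_nonneg.2 h4)
  have := mul_nonneg (sub_nonneg.2 ht.2) (sub_nonneg.2 h4)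
  refine ⟨?_, ?_, h3, ?_⟩ <;> simp only <;> nlinarith

theorem continuousOn_segmentAverage {κ : ℝ → ℝ} (hκ : IntegrableOn κ (Ioc 0 1)) {F : ℝ → ℝ → ℝ}
    (hF : ContinuousOn (fun z : ℝ × ℝ => F z.1 z.2) (triangle a b)) :
    ContinuousOn (fun z : ℝ × ℝ => segmentAverage κ F z.1 z.2) (triangle a b) := by
  obtain ⟨C, hC⟩ := isCompact_triangle.exists_bound_of_continuousOn hF
  refine continuousOn_of_dominated (bound := fun t => ‖κ t‖ * C) ?_ ?_ (hκ.norm.mul_const C) ?_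
  · intro z hz
    refine hκ.aestronglyMeasurable.mul (ContinuousOn.aestronglyMeasurable ?_ measurableSet_Ioc)
    exact hF.comp (f := fun t : ℝ => (z.2 + t * (z.1 - z.2), z.2)) (by fun_prop)
      fun t ht => segment_mem_triangle hz ht
  · intro z hz
    filter_upwards [ae_restrict_mem measurableSet_Ioc] with t ht
    rw [norm_mul]
    gcongr
    exact hC _ (segment_mem_triangle hz ht)
  · filter_upwards [ae_restrict_mem measurableSet_Ioc] with t ht
    refine continuousOn_const.mul ?_
    exact hF.comp (f := fun z : ℝ × ℝ => (z.2 + t * (z.1 - z.2), z.2)) (by fun_prop)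
      fun z hz => segment_mem_triangle hz ht

/-- Differentiating in `s` under the integral multiplies the weight by `t ∈ (0, 1]`, which keeps it
integrable; hence the induction is over all weights. -/
theorem ContPartials.segmentAverage {k : ℕ} {κ : ℝ → ℝ} (hκ : IntegrableOn κ (Ioc 0 1))
    {F : ℝ → ℝ → ℝ} (hF : ContPartials a b k F) : ContPartials a b k (segmentAverage κ F) := by
  induction k generalizing κ F with
  | zero => exact continuousOn_segmentAverage hκ hF
  | succ k ih =>
    obtain ⟨hc, F', hF', hd⟩ := hF
    have hκ' : IntegrableOn (fun t => t * κ t) (Ioc 0 1) := by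
      refine Integrable.bdd_mul (c := 1) hκ (by fun_prop) ?_
      filter_upwards [ae_restrict_mem measurableSet_Ioc] with t ht
      rw [Real.norm_of_nonneg ht.1.le]; exact ht.2
    refine ⟨continuousOn_segmentAverage hκ hc, _, ih hκ' hF', fun w s h1 h2 h3 => ?_⟩
    obtain ⟨C, hC⟩ := isCompact_triangle.exists_bound_of_continuousOn hF'.continuousOn
    have hT : ∀ x ∈ Ioo w b, (x, w) ∈ triangle a b := fun x hx =>
      ⟨h1.trans hx.1.le, hx.2.le, h1, hx.1.le⟩
    have hmeas : ∀ {G : ℝ → ℝ → ℝ} {κ : ℝ → ℝ}, IntegrableOn κ (Ioc 0 1) →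
        ContinuousOn (fun z : ℝ × ℝ => G z.1 z.2) (triangle a b) → ∀ x ∈ Ioo w b,
        AEStronglyMeasurable (fun t => κ t * G (w + t * (x - w)) w) (volume.restrict (Ioc 0 1)) := by
      intro G κ hκ hG x hx
      refine hκ.aestronglyMeasurable.mul (ContinuousOn.aestronglyMeasurable ?_ measurableSet_Ioc)
      exact hG.comp (f := fun t : ℝ => (w + t * (x - w), w)) (by fun_prop)
        fun t ht => segment_mem_triangle (hT x hx) ht
    obtain ⟨C', hC'⟩ := isCompact_triangle.exists_bound_of_continuousOn hc
    refine (hasDerivAt_integral_of_dominated_loc_of_deriv_le (s := Ioo w b)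
      (bound := fun t => ‖t * κ t‖ * C)
      (F := fun x t => κ t * F (w + t * (x - w)) w)
      (F' := fun x t => t * κ t * F' (w + t * (x - w)) w)
      (Ioo_mem_nhds h2 h3) ?_ ?_ ?_ ?_ (hκ'.norm.mul_const C) ?_).2
    · filter_upwards [Ioo_mem_nhds h2 h3] with x hx using hmeas hκ hc x hx
    · refine Integrable.mono' (hκ.norm.mul_const C') (hmeas hκ hc s ⟨h2, h3⟩) ?_
      filter_upwards [ae_restrict_mem measurableSet_Ioc] with t ht
      rw [norm_mul]
      gcongr
      exact hC' _ (segment_mem_triangle (hT s ⟨h2, h3⟩) ht)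
    · exact hmeas hκ' hF'.continuousOn s ⟨h2, h3⟩
    · filter_upwards [ae_restrict_mem measurableSet_Ioc] with t ht x hx
      rw [norm_mul]
      gcongr
      exact hC _ (segment_mem_triangle (hT x hx) ht)
    · filter_upwards [ae_restrict_mem measurableSet_Ioc] with t ht x hx
      have hx0 : 0 < x - w := sub_pos.2 hx.1
      have hin := hd w (w + t * (x - w)) h1 (by nlinarith [mul_pos ht.1 hx0])
        (by nlinarith [mul_nonneg (sub_nonneg.2 ht.2) hx0.le, hx.2])
      have hl : HasDerivAt (fun x => w + t * (x - w)) t x := by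
        simpa using (((hasDerivAt_id x).sub_const w).const_mul t).const_add w
      convert! (hin.comp x hl).const_mul (κ t) using 1
      ring

theorem integrableOn_abel_weight {β γ : ℝ} (hβ : -1 < β) (hγ : 0 ≤ γ) :
    IntegrableOn (fun t : ℝ => (1 - t) ^ γ * t ^ β) (Ioc 0 1) := by
  have h := (intervalIntegrable_iff_integrableOn_Ioc_of_le zero_le_one).1
    (intervalIntegral.intervalIntegrable_rpow' (a := 0) (b := 1) hβ)
  refine Integrable.bdd_mul (c := 1) h ?_ ?_
  · exact ((continuous_const.sub continuous_id).rpow_const fun _ => Or.inr hγ).aestronglyMeasurable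
  · filter_upwards [ae_restrict_mem measurableSet_Ioc] with t ht
    have h0 : 0 ≤ 1 - t := sub_nonneg.2 ht.2
    rw [Real.norm_of_nonneg (Real.rpow_nonneg h0 _)]
    exact Real.rpow_le_one h0 (by linarith [ht.1]) hγ

theorem integral_abel_weight_pos {β γ : ℝ} (hβ : -1 < β) (hγ : 0 ≤ γ) :
    0 < ∫ t in Ioc (0 : ℝ) 1, (1 - t) ^ γ * t ^ β := by
  rw [← intervalIntegral.integral_of_le zero_le_one]
  refine intervalIntegral.intervalIntegral_pos_of_pos_on
    ((intervalIntegrable_iff_integrableOn_Ioc_of_le zero_le_one).2 (integrableOn_abel_weight hβ hγ))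
    (fun t ht => ?_) zero_lt_one
  exact mul_pos (Real.rpow_pos_of_pos (sub_pos.2 ht.2) _) (Real.rpow_pos_of_pos ht.1 _)

/-- Substitution `p = w + t * (s - w)`; the extra power of `s - w` is its Jacobian. -/
theorem integral_abel_kernel {β γ : ℝ} {N : ℕ} (hN : γ + β = N) {F : ℝ → ℝ} {w s : ℝ} (hws : w ≤ s) :
    ∫ p in Icc w s, (s - p) ^ γ * ((p - w) ^ β * F p) =
      (s - w) ^ (N + 1) * ∫ t in Ioc (0 : ℝ) 1, (1 - t) ^ γ * t ^ β * F (w + t * (s - w)) := by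
  rcases hws.eq_or_lt with rfl | hlt
  · simp
  have hpos : 0 < s - w := sub_pos.2 hlt
  rw [integral_Icc_eq_integral_Ioc, ← intervalIntegral.integral_of_le hws,
    ← intervalIntegral.integral_of_le zero_le_one]
  have hsub := intervalIntegral.smul_integral_comp_add_mul (a := 0) (b := 1)
    (fun p => (s - p) ^ γ * ((p - w) ^ β * F p)) (s - w) w
  simp only [mul_zero, add_zero, mul_one, add_sub_cancel] at hsub
  rw [← hsub, smul_eq_mul, ← intervalIntegral.integral_const_mul,
    ← intervalIntegral.integral_const_mul]
  refine intervalIntegral.integral_congr fun t ht => ?_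
  rw [uIcc_of_le zero_le_one] at ht
  have e1 : s - (w + (s - w) * t) = (s - w) * (1 - t) := by ring
  have e2 : w + (s - w) * t - w = (s - w) * t := by ring
  rw [e1, e2, Real.mul_rpow hpos.le (sub_nonneg.2 ht.2), Real.mul_rpow hpos.le ht.1,
    mul_comm (s - w) t, pow_succ, ← Real.rpow_natCast, ← hN, Real.rpow_add hpos]
  ring

/-- Uniqueness for generalized Abel equations. -/
theorem ae_eq_zero_of_abel (hab : a < b) {β : ℝ} (hβ : -1 < β) {M : ℝ → ℝ → ℝ}
    (hM : ContDiffOn ℝ ∞ (fun z : ℝ × ℝ => M z.1 z.2) (triangle a b))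
    (hdiag : ∀ t ∈ Icc a b, M t t ≠ 0) {φ : ℝ → E} (hφ : Integrable φ)
    (h : ∀ᵐ p ∂(volume.restrict (Icc a b)),
      ∫ w in Icc a p, ((p - w) ^ β * M p w) • φ w = 0) :
    ∀ᵐ t ∂(volume.restrict (Icc a b)), φ t = 0 := by
  -- Rounding up makes `γ ≥ 0`, so that `(s - p) ^ γ` is continuous and bounded. For `-1 < β ≤ 0`
  -- this gives `N = 0` and `γ = -β`.
  set N := ⌈β⌉₊
  set γ : ℝ := N - β with hγdef
  have hγ : 0 ≤ γ := sub_nonneg.2 (Nat.le_ceil β)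
  refine ae_eq_zero_of_volterra_pow hab hφ (N := N + 1)
    (L := segmentAverage (fun t => (1 - t) ^ γ * t ^ β) M)
    ((hM.contPartials hab _).segmentAverage (integrableOn_abel_weight hβ hγ)) ?_ ?_
  · intro t ht
    simp only [segmentAverage, sub_self, mul_zero, add_zero, integral_mul_const]
    exact mul_ne_zero (integral_abel_weight_pos hβ hγ).ne' (hdiag t ht)
  filter_upwards [ae_restrict_mem measurableSet_Icc] with s hs
  have hg : Continuous fun p : ℝ => (s - p) ^ γ :=
    (continuous_const.sub continuous_id).rpow_const fun _ => Or.inr hγ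
  obtain ⟨C, hC⟩ := isCompact_Icc.exists_bound_of_continuousOn (hg.continuousOn (s := Icc a s))
  have hsw := integral_triangle_swap (F := fun p w => ((p - w) ^ β * M p w) • φ w)
    (integrable_indicator_triangle hβ hM.continuousOn hφ) hs (g := fun p => (s - p) ^ γ) (C := C)
    hg.continuousOn hC
  calc
    _ = ∫ w in Icc a s, ∫ p in Icc w s, (s - p) ^ γ • ((p - w) ^ β * M p w) • φ w := by
      refine setIntegral_congr_fun measurableSet_Icc fun w hw => ?_
      simp only [smul_smul, integral_smul_const, segmentAverage]
      rw [integral_abel_kernel (N := N) (by rw [hγdef]; ring) (F := fun p => M p w) hw.2]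
    _ = 0 := by
      rw [← hsw]
      refine integral_eq_zero_of_ae ?_
      filter_upwards [ae_restrict_of_ae_restrict_of_subset (Icc_subset_Icc_right hs.2) h] with p hp
      rw [hp, smul_zero]
      rfl

end Abel

/-! ### The singularity of the weight at the diagonal -/

section Kernel

variable {a b : ℝ}

theorem hasDerivAt_snd_of_contDiffOn_triangle {ν : ℝ → ℝ → ℝ}
    (hν : ContDiffOn ℝ ∞ (fun z : ℝ × ℝ => ν z.1 z.2) (triangle a b)) {p w : ℝ}
    (h1 : a < w) (h2 : w < p) (h3 : p ≤ b) :
    HasDerivAt (fun t => ν p t)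
      (fderivWithin ℝ (fun z : ℝ × ℝ => ν z.1 z.2) (triangle a b) (p, w) (0, 1)) w := by
  have hT : (p, w) ∈ triangle a b := ⟨(h1.trans h2).le, h3, h1.le, h2.le⟩
  have hd := ((hν.differentiableOn (by simp)) (p, w) hT).hasFDerivWithinAt
  have hl : HasDerivWithinAt (fun t : ℝ => (p, t)) (0, 1) (Icc a p) w :=
    (hasDerivWithinAt_const w _ p).prodMk (hasDerivWithinAt_id w _)
  exact (hd.comp_hasDerivWithinAt (f := fun t : ℝ => (p, t)) w hl (fun t ht =>
    ⟨(h1.trans h2).le, h3, ht.1, ht.2⟩)).hasDerivAt (Icc_mem_nhds h1 h2)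

/-- The weight of the transform is a fractional power of `p - w` times a smooth function. -/
theorem exists_weight_factorization (n : ℕ) {q : ℕ} (hq : 1 ≤ q) (hab : a < b) {ν r : ℝ → ℝ → ℝ}
    (hν : ContDiffOn ℝ ∞ (fun z : ℝ × ℝ => ν z.1 z.2) (triangle a b))
    (hdiag : ∀ p ∈ Icc a b, ν p p ≠ 0)
    (hr : ∀ p w : ℝ, (p, w) ∈ triangle a b → r p w = (p - w) ^ ((q : ℝ) / 2) * ν p w) :
    ∃ (β : ℝ) (M : ℝ → ℝ → ℝ), -1 < β ∧
      ContDiffOn ℝ ∞ (fun z : ℝ × ℝ => M z.1 z.2) (triangle a b) ∧ (∀ p ∈ Icc a b, M p p ≠ 0) ∧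
      ∀ p w, a < w → w < p → p ≤ b →
        Real.sqrt (1 + (deriv (fun t => r p t) w) ^ 2) * r p w ^ (n - 2) = (p - w) ^ β * M p w := by
  set ν' : ℝ → ℝ → ℝ := fun p w =>
    fderivWithin ℝ (fun z : ℝ × ℝ => ν z.1 z.2) (triangle a b) (p, w) (0, 1)
  have hν' : ContDiffOn ℝ ∞ (fun z : ℝ × ℝ => ν' z.1 z.2) (triangle a b) :=
    (hν.fderivWithin (uniqueDiffOn_triangle hab) (m := ∞) (by simp)).clm_apply contDiffOn_const
  -- `D` is what remains of `∂r/∂w` after extracting `(p - w) ^ (q / 2 - 1)`; on the diagonal it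
  -- equals `-(q / 2) * ν`.
  set D : ℝ → ℝ → ℝ := fun p w => -(q / 2) * ν p w + (p - w) * ν' p w with hDdef
  have hu : ContDiffOn ℝ ∞ (fun z : ℝ × ℝ => z.1 - z.2) (triangle a b) := by fun_prop
  have hD : ContDiffOn ℝ ∞ (fun z : ℝ × ℝ => D z.1 z.2) (triangle a b) :=
    (contDiffOn_const.mul hν).add (hu.mul hν')
  have hderiv : ∀ p w, a < w → w < p → p ≤ b →
      deriv (fun t => r p t) w = (p - w) ^ ((q : ℝ) / 2 - 1) * D p w := by
    intro p w h1 h2 h3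
    have hpos : 0 < p - w := sub_pos.2 h2
    have hd := ((((hasDerivAt_id w).const_sub p).rpow_const (p := (q : ℝ) / 2) (Or.inl hpos.ne')).mul
      (hasDerivAt_snd_of_contDiffOn_triangle hν h1 h2 h3))
    have he : (fun t => r p t) =ᶠ[nhds w] fun t => (p - t) ^ ((q : ℝ) / 2) * ν p t := by
      filter_upwards [Ioo_mem_nhds h1 h2] with t ht
      exact hr p t ⟨(ht.1.trans ht.2).le, h3, ht.1.le, ht.2.le⟩
    rw [he.deriv_eq]
    refine (hd.deriv).trans ?_
    have : (p - w) ^ ((q : ℝ) / 2) = (p - w) ^ ((q : ℝ) / 2 - 1) * (p - w) := by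
      rw [← Real.rpow_add_one hpos.ne']; ring_nf
    simp only [hDdef, id, this]
    ring
  have hpow : ∀ p w, a < w → w < p → p ≤ b →
      r p w ^ (n - 2) = (p - w) ^ ((q : ℝ) / 2 * (n - 2 : ℕ)) * ν p w ^ (n - 2) := by
    intro p w h1 h2 h3
    have hpos : 0 < p - w := sub_pos.2 h2
    rw [hr p w ⟨(h1.trans h2).le, h3, h1.le, h2.le⟩, mul_pow, Real.rpow_mul hpos.le,
      Real.rpow_natCast]
  have hexp : (0 : ℝ) ≤ (q : ℝ) / 2 * (n - 2 : ℕ) := by positivity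
  -- For `q = 1` the derivative of `r` is singular, and `(p - w) ^ (-1 / 2)` is pulled out of the
  -- root; the remaining radicand `(p - w) + D ^ 2` is positive at the diagonal because `ν p p ≠ 0`.
  -- For `q ≥ 2` the radicand is already smooth, as `(p - w) ^ (q - 2)` is a natural power.
  rcases hq.eq_or_lt with rfl | hq2
  · have hpos : ∀ z ∈ triangle a b, 0 < (z.1 - z.2) + D z.1 z.2 ^ 2 := by
      rintro ⟨p, w⟩ ⟨h1, h2, h3, h4⟩
      rcases h4.eq_or_lt with h | h
      · simp only at h
        subst h
        have := hdiag _ ⟨h1, h2⟩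
        simp only [hDdef, sub_self, zero_mul, add_zero, zero_add]
        positivity
      · exact add_pos_of_pos_of_nonneg (sub_pos.2 h) (sq_nonneg _)
    refine ⟨(1 : ℕ) / 2 * (n - 2 : ℕ) + -1 / 2,
      fun p w => Real.sqrt ((p - w) + D p w ^ 2) * ν p w ^ (n - 2), by linarith, ?_, ?_, ?_⟩
    · exact ((hu.add (hD.pow 2)).sqrt fun z hz => (hpos z hz).ne').mul (hν.pow _)
    · intro p hp
      exact mul_ne_zero (Real.sqrt_pos.2 (hpos (p, p) ⟨hp.1, hp.2, hp.1, le_rfl⟩)).ne'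
        (pow_ne_zero _ (hdiag p hp))
    · intro p w h1 h2 h3
      have hpw : 0 < p - w := sub_pos.2 h2
      have hs : 1 + ((p - w) ^ (((1 : ℕ) : ℝ) / 2 - 1) * D p w) ^ 2 =
          ((p - w) ^ (-1 / 2 : ℝ)) ^ 2 * ((p - w) + D p w ^ 2) := by
        have e : (((1 : ℕ) : ℝ) / 2 - 1) = -1 / 2 := by norm_num
        have e2 : ((p - w) ^ (-1 / 2 : ℝ)) ^ 2 * (p - w) = 1 := by
          rw [← Real.rpow_natCast, ← Real.rpow_mul hpw.le, ← Real.rpow_add_one hpw.ne']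
          norm_num
        rw [e, mul_add _ (p - w), e2]
        ring
      rw [hderiv p w h1 h2 h3, hpow p w h1 h2 h3, hs, Real.sqrt_mul (sq_nonneg _),
        Real.sqrt_sq (Real.rpow_nonneg hpw.le _), Real.rpow_add hpw]
      ring
  · have hpos : ∀ z ∈ triangle a b, 0 < 1 + (z.1 - z.2) ^ (q - 2) * D z.1 z.2 ^ 2 := by
      rintro ⟨p, w⟩ ⟨h1, h2, h3, h4⟩
      have : 0 ≤ p - w := sub_nonneg.2 h4
      simp only
      positivity
    refine ⟨q / 2 * (n - 2 : ℕ),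
      fun p w => Real.sqrt (1 + (p - w) ^ (q - 2) * D p w ^ 2) * ν p w ^ (n - 2), by linarith, ?_, ?_, ?_⟩
    · exact ((contDiffOn_const.add ((hu.pow _).mul (hD.pow 2))).sqrt
        fun z hz => (hpos z hz).ne').mul (hν.pow _)
    · intro p hp
      exact mul_ne_zero (Real.sqrt_pos.2 (hpos (p, p) ⟨hp.1, hp.2, hp.1, le_rfl⟩)).ne'
        (pow_ne_zero _ (hdiag p hp))
    · intro p w h1 h2 h3
      have hpw : 0 < p - w := sub_pos.2 h2
      have e : ((p - w) ^ ((q : ℝ) / 2 - 1)) ^ 2 = (p - w) ^ (q - 2) := by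
        rw [← Real.rpow_natCast, ← Real.rpow_mul hpw.le, ← Real.rpow_natCast]
        congr 1
        rw [Nat.cast_sub hq2]
        push_cast
        ring
      rw [hderiv p w h1 h2 h3, hpow p w h1 h2 h3, mul_pow, e]
      ring

end Kernel

/-! ### Translations depending on a parameter -/

section Shear

variable {Z V E : Type*} [MeasurableSpace Z] [NormedAddCommGroup V] [MeasurableSpace V]
  [BorelSpace V] [SecondCountableTopology V] [NormedAddCommGroup E] [NormedSpace ℝ E]

theorem measurePreserving_shear (μ : Measure Z) [SFinite μ] (lam : Measure V) [SFinite lam]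
    [lam.IsAddLeftInvariant] {τ : Z → V} (hτ : Measurable τ) :
    MeasurePreserving (fun x : Z × V => (x.1, τ x.1 + x.2)) (μ.prod lam) (μ.prod lam) :=
  (MeasurePreserving.id μ).skew_product (g := fun z y => τ z + y)
    ((hτ.comp measurable_fst).add measurable_snd)
    (.of_forall fun z => map_add_left_eq_self lam (τ z))

theorem integral_shear {μ : Measure Z} [SFinite μ] {lam : Measure V} [SFinite lam]
    [lam.IsAddLeftInvariant] {τ : Z → V} (hτ : Measurable τ) {G : Z × V → E}
    (hG : AEStronglyMeasurable G (μ.prod lam)) :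
    ∫ x, G (x.1, τ x.1 + x.2) ∂(μ.prod lam) = ∫ x, G x ∂(μ.prod lam) := by
  have h := measurePreserving_shear μ lam hτ
  have := integral_map h.measurable.aemeasurable (f := G) (by rwa [h.map_eq])
  rw [h.map_eq] at this
  exact this.symm

end Shear

/-! ### Horizontal moments of a function with vanishing averages -/

section Moments

variable {Ω V : Type*} [MeasurableSpace Ω] [NormedAddCommGroup V] [InnerProductSpace ℝ V]
  [FiniteDimensional ℝ V] [MeasurableSpace V] [BorelSpace V] {a b : ℝ}

/-- For almost every `p` the weighted function is integrable on `[a, p] × V`. -/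
theorem ae_integrable_weight_smul {β : ℝ} (hβ : -1 < β) {M : ℝ → ℝ → ℝ}
    (hM : ContinuousOn (fun z : ℝ × ℝ => M z.1 z.2) (triangle a b)) {F : V × ℝ → ℂ}
    (hF : Integrable F) :
    ∀ᵐ p ∂(volume.restrict (Icc a b)),
      Integrable (fun x : ℝ × V => ((p - x.1) ^ β * M p x.1) • F (x.2, x.1))
        ((volume.restrict (Icc a p)).prod volume) := by
  have hF' : Integrable (fun x : ℝ × V => F (x.2, x.1)) (volume.prod volume) := hF.swap
  -- Applied to `w ↦ ∫ ‖F (x, w)‖ dx`; the slices of this integrable function at almost every `p`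
  -- give the bound needed for Tonelli.
  have hT := integrable_indicator_triangle hβ hM hF'.norm.integral_prod_left
  filter_upwards [ae_restrict_of_ae hT.prod_right_ae, ae_restrict_mem measurableSet_Icc] with p hp hpI
  have hmeas : AEStronglyMeasurable (fun w => (p - w) ^ β * M p w) (volume.restrict (Icc a p)) := by
    refine AEStronglyMeasurable.mul
      ((measurable_const.sub measurable_id).pow_const β).aestronglyMeasurable (ContinuousOn.aestronglyMeasurable ?_ measurableSet_Icc)
    exact hM.comp (f := fun w : ℝ => (p, w)) (by fun_prop) fun w hw => ⟨hpI.1, hpI.2, hw.1, hw.2⟩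
  have hFm : AEStronglyMeasurable (fun x : ℝ × V => F (x.2, x.1))
      ((volume.restrict (Icc a p)).prod volume) :=
    hF'.aestronglyMeasurable.mono_measure (Measure.prod_mono Measure.restrict_le_self le_rfl)
  have hsm : AEStronglyMeasurable (fun x : ℝ × V => ((p - x.1) ^ β * M p x.1) • F (x.2, x.1))
      ((volume.restrict (Icc a p)).prod volume) := hmeas.comp_fst.smul hFm
  refine (integrable_prod_iff hsm).2 ⟨?_, ?_⟩
  · filter_upwards [ae_restrict_of_ae hF'.prod_right_ae] with w hw using hw.smul ((p - w) ^ β * M p w)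
  · simp only [norm_smul, integral_const_mul]
    have h1 : IntegrableOn (fun w => ((p - w) ^ β * M p w) • ∫ x, ‖F (x, w)‖) (Icc a p) := by
      refine hp.integrableOn.congr_fun (fun w hw => ?_) measurableSet_Icc
      have : (p, w) ∈ triangle a b := ⟨hpI.1, hpI.2, hw.1, hw.2⟩
      simp [this]
    refine h1.norm.congr (.of_forall fun w => ?_)
    simp only [norm_smul]
    rw [Real.norm_of_nonneg (integral_nonneg fun _ => norm_nonneg _)]

theorem integrable_weight_smul_prod (σ : Measure Ω) [IsFiniteMeasure σ] {k : ℝ → ℝ} {p : ℝ}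
    {F : V × ℝ → ℂ} (hk : Integrable (fun x : ℝ × V => k x.1 • F (x.2, x.1))
        ((volume.restrict (Icc a p)).prod volume))
    {c : Ω × ℝ → ℝ} (hc : Measurable c) {C : ℝ} (hC : ∀ z, |c z| ≤ C) :
    Integrable (fun x : (Ω × ℝ) × V => (c x.1 * k x.1.2) • F (x.2, x.1.2))
      ((σ.prod (volume.restrict (Icc a p))).prod volume) := by
  have h1 := (measurePreserving_prodAssoc σ (volume.restrict (Icc a p))
    (volume : Measure V)).integrable_comp_of_integrable (hk.comp_snd σ)
  have h2 := h1.bdd_smul (φ := fun x : (Ω × ℝ) × V => c x.1) C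
    (hc.comp measurable_fst).aestronglyMeasurable (.of_forall fun x => hC x.1)
  refine h2.congr (.of_forall fun x => ?_)
  simp [MeasurableEquiv.prodAssoc, mul_assoc]

theorem ae_integrable_shifted (σ : Measure Ω) [IsFiniteMeasure σ] {k : ℝ → ℝ} {p : ℝ}
    {F : V × ℝ → ℂ} (hk : Integrable (fun x : ℝ × V => k x.1 • F (x.2, x.1))
        ((volume.restrict (Icc a p)).prod volume))
    {τ : Ω × ℝ → V} (hτ : Measurable τ) :
    ∀ᵐ y : V, Integrable (fun z : Ω × ℝ => k z.2 • F (τ z + y, z.2))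
      (σ.prod (volume.restrict (Icc a p))) := by
  have h := integrable_weight_smul_prod σ hk (c := fun _ => 1) measurable_const (C := 1) (by simp)
  simp only [one_mul] at h
  exact ((measurePreserving_shear _ _ hτ).integrable_comp_of_integrable h).prod_left_ae

/-- If all averages of `h` over shifted families vanish, so do all its horizontal moments. -/
theorem ae_moment_eq_zero (hab : a < b) (σ : Measure Ω) [IsFiniteMeasure σ] [NeZero σ]
    {β : ℝ} (hβ : -1 < β) {M : ℝ → ℝ → ℝ}
    (hM : ContDiffOn ℝ ∞ (fun z : ℝ × ℝ => M z.1 z.2) (triangle a b))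
    (hdiag : ∀ t ∈ Icc a b, M t t ≠ 0) {τ : ℝ → Ω × ℝ → V} (hτ : ∀ p ∈ Icc a b, Measurable (τ p))
    (hτb : ∀ p ∈ Icc a b, ∃ R, ∀ z, ‖τ p z‖ ≤ R) {h : V × ℝ → ℂ} (ξ : V)
    (hint : ∀ j : ℕ, Integrable fun x : V × ℝ => (inner ℝ x.1 ξ) ^ j • h x)
    (hzero : ∀ᵐ p ∂(volume.restrict (Icc a b)), ∀ᵐ y : V,
      ∫ z, ((p - z.2) ^ β * M p z.2) • h (τ p z + y, z.2) ∂(σ.prod (volume.restrict (Icc a p))) = 0)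
    (m : ℕ) :
    ∀ᵐ w ∂(volume.restrict (Icc a b)), ∫ x : V, (inner ℝ x ξ) ^ m • h (x, w) = 0 := by
  induction m using Nat.strong_induction_on with
  | _ m ih =>
  have hgood := fun j => ae_integrable_weight_smul hβ hM.continuousOn (hint j)
  refine ae_eq_zero_of_abel hab hβ hM hdiag (φ := fun w => ∫ x : V, (inner ℝ x ξ) ^ m • h (x, w))
    (hint m).integral_prod_right ?_
  filter_upwards [ae_all_iff.2 hgood, hzero, ae_restrict_mem measurableSet_Icc] with p hgp hzp hp
  obtain ⟨R, hR⟩ := hτb p hp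
  set k : ℝ → ℝ := fun w => (p - w) ^ β * M p w
  set μ := σ.prod (volume.restrict (Icc a p))
  have hτi : Measurable fun z => inner ℝ (τ p z) ξ := (hτ p hp).inner_const
  -- Coefficient of `⟨x, ξ⟩ ^ j` in `(⟨x, ξ⟩ - ⟨τ, ξ⟩) ^ m`, where `x = τ + y`.
  set c : ℕ → Ω × ℝ → ℝ := fun j z => (-inner ℝ (τ p z) ξ) ^ (m - j) * (m.choose j)
  have hcm : ∀ j, Measurable (c j) := fun j => (hτi.neg.pow_const _).mul_const _
  have hcb : ∀ j z, |c j z| ≤ (R * ‖ξ‖) ^ (m - j) * (m.choose j) := by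
    intro j z
    simp only [c, abs_mul, abs_pow, abs_neg, Nat.abs_cast]
    gcongr
    exact (abs_real_inner_le_norm _ _).trans (by gcongr; exact hR z)
  set G : ℕ → (Ω × ℝ) × V → ℂ := fun j x =>
    (c j x.1 * k x.1.2) • ((inner ℝ x.2 ξ) ^ j • h (x.2, x.1.2)) with hGdef
  have hG : ∀ j, Integrable (G j) (μ.prod volume) := fun j =>
    integrable_weight_smul_prod (F := fun x : V × ℝ => (inner ℝ x.1 ξ) ^ j • h x) (k := k)
      σ (hgp j) (hcm j) (hcb j)
  have hGs : ∀ j, Integrable (fun x : (Ω × ℝ) × V => G j (x.1, τ p x.1 + x.2)) (μ.prod volume) :=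
    fun j => (measurePreserving_shear μ volume (hτ p hp)).integrable_comp_of_integrable
      (g := G j) (hG j)
  have hbinom : ∀ (z : Ω × ℝ) (y : V), ∑ j ∈ Finset.range (m + 1), G j (z, τ p z + y) =
      (inner ℝ y ξ) ^ m • (k z.2 • h (τ p z + y, z.2)) := by
    intro z y
    have hy : inner ℝ y ξ = inner ℝ (τ p z + y) ξ + -inner ℝ (τ p z) ξ := by
      rw [inner_add_left]; ring
    rw [hy, add_pow, Finset.sum_smul]
    refine Finset.sum_congr rfl fun j _ => ?_
    simp only [hGdef, smul_smul, c]
    congr 1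
    ring
  have hfib : ∀ j, ∫ x, G j x ∂(μ.prod volume) =
      ∫ z, (c j z * k z.2) • (∫ x : V, (inner ℝ x ξ) ^ j • h (x, z.2)) ∂μ := by
    intro j
    rw [integral_prod _ (hG j)]
    simp only [hGdef, integral_smul]
  have hsum : ∑ j ∈ Finset.range (m + 1), ∫ x, G j x ∂(μ.prod volume) = 0 := by
    calc
      _ = ∑ j ∈ Finset.range (m + 1), ∫ x, G j (x.1, τ p x.1 + x.2) ∂(μ.prod volume) :=
        Finset.sum_congr rfl fun j _ => (integral_shear (hτ p hp) (hG j).aestronglyMeasurable).symm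
      _ = ∫ y, ∫ z, ∑ j ∈ Finset.range (m + 1), G j (z, τ p z + y) ∂μ := by
        rw [← integral_finsetSum _ fun j _ => hGs j,
          integral_prod_symm _ (integrable_finsetSum _ fun j _ => hGs j)]
      _ = 0 := by
        refine integral_eq_zero_of_ae ?_
        filter_upwards [hzp] with y hy
        simp only [hbinom, integral_smul]
        rw [hy, smul_zero]
        rfl
  have hlow : ∀ j < m, ∫ x, G j x ∂(μ.prod volume) = 0 := by
    intro j hj
    rw [hfib]
    refine integral_eq_zero_of_ae ?_
    have := ae_restrict_of_ae_restrict_of_subset (Icc_subset_Icc_right hp.2) (ih j hj)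
    filter_upwards [Measure.quasiMeasurePreserving_snd.ae this] with z hz
    rw [hz, smul_zero]
    rfl
  rw [Finset.sum_range_succ, Finset.sum_eq_zero fun j hj => hlow j (Finset.mem_range.1 hj),
    zero_add, hfib] at hsum
  simp only [c, Nat.sub_self, pow_zero, Nat.choose_self, Nat.cast_one, one_mul] at hsum
  -- In the top term `j = m` the coefficient is `1`, so nothing depends on `Ω` and the total mass of
  -- `σ` factors out.
  rw [integral_fun_snd (fun w => k w • ∫ x : V, (inner ℝ x ξ) ^ m • h (x, w))] at hsum
  exact (smul_eq_zero.1 hsum).resolve_left (by simp [measureReal_eq_zero_iff, NeZero.ne σ])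

end Moments

/-! ### Fourier uniqueness for integrable functions -/

section CharFun

variable {E : Type*} [NormedAddCommGroup E] [NormedSpace ℝ E] [MeasurableSpace E] [BorelSpace E]
  {μ : Measure E}

theorem integrable_cexp_dual_mul {g : E → ℂ} (hg : Integrable g μ) (L : StrongDual ℝ E) :
    Integrable (fun x => Complex.exp (L x * Complex.I) * g x) μ :=
  hg.bdd_mul (c := 1) (by fun_prop) (.of_forall fun x => (Complex.norm_exp_ofReal_mul_I _).le)

variable [SecondCountableTopology E] [CompleteSpace E]

/-- A real integrable function with vanishing characteristic function is zero. -/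
theorem ae_eq_zero_of_charFun_real {g : E → ℝ} (hg : Integrable g μ)
    (h : ∀ L : StrongDual ℝ E, ∫ x, Complex.exp (L x * Complex.I) * (g x : ℂ) ∂μ = 0) :
    g =ᵐ[μ] 0 := by
  have hfin : ∀ {f : E → ℝ}, Integrable f μ →
      IsFiniteMeasure (μ.withDensity fun x => ENNReal.ofReal (f x)) := fun hf =>
    isFiniteMeasure_withDensity_ofReal hf.2
  have := hfin hg
  have := hfin hg.neg
  have hchar : ∀ {f : E → ℝ}, Integrable f μ → ∀ L : StrongDual ℝ E,
      charFunDual (μ.withDensity fun x => ENNReal.ofReal (f x)) L =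
        ∫ x, Complex.exp (L x * Complex.I) * ((max (f x) 0 : ℝ) : ℂ) ∂μ := by
    intro f hf L
    rw [charFunDual_apply, integral_withDensity_eq_integral_toReal_smul₀
      hf.aestronglyMeasurable.aemeasurable.ennreal_ofReal (.of_forall fun _ => ENNReal.ofReal_lt_top)]
    refine integral_congr_ae (.of_forall fun x => ?_)
    simp only [ENNReal.toReal_ofReal', Complex.real_smul]
    ring
  -- The positive and negative parts of `g` are densities of finite measures with equal
  -- characteristic functions, so the two measures coincide.
  have hm := Measure.ext_of_charFunDual (μ := μ.withDensity fun x => ENNReal.ofReal (g x))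
    (ν := μ.withDensity fun x => ENNReal.ofReal ((-g) x)) (by
      ext L
      rw [hchar hg, hchar hg.neg, ← sub_eq_zero, ← integral_sub
        (integrable_cexp_dual_mul (g := fun x => ((max (g x) 0 : ℝ) : ℂ)) hg.pos_part.ofReal L)
        (integrable_cexp_dual_mul (g := fun x => ((max ((-g) x) 0 : ℝ) : ℂ))
          hg.neg.pos_part.ofReal L), ← h L]
      refine integral_congr_ae (.of_forall fun x => ?_)
      simp only [← mul_sub, ← Complex.ofReal_sub, Pi.neg_apply]
      congr 2
      exact max_zero_sub_max_neg_zero_eq_self (g x))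
  rw [withDensity_eq_iff hg.aestronglyMeasurable.aemeasurable.ennreal_ofReal
    hg.neg.aestronglyMeasurable.aemeasurable.ennreal_ofReal hg.lintegral_lt_top.ne] at hm
  filter_upwards [hm] with x hx
  have := congrArg ENNReal.toReal hx
  simp only [ENNReal.toReal_ofReal', Pi.neg_apply] at this
  have h2 := max_zero_sub_max_neg_zero_eq_self (g x)
  simp only [Pi.zero_apply]
  linarith

/-- An integrable function with vanishing characteristic function is zero. -/
theorem ae_eq_zero_of_charFun {g : E → ℂ} (hg : Integrable g μ)
    (h : ∀ L : StrongDual ℝ E, ∫ x, Complex.exp (L x * Complex.I) * g x ∂μ = 0) :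
    g =ᵐ[μ] 0 := by
  have hconj : ∀ L : StrongDual ℝ E,
      ∫ x, Complex.exp (L x * Complex.I) * (starRingEnd ℂ) (g x) ∂μ = 0 := by
    intro L
    -- Conjugation reverses the frequency, so the hypothesis at `-L` serves the conjugate at `L`,
    -- and hence the real and imaginary parts.
    have := congrArg (starRingEnd ℂ) (h (-L))
    rw [← integral_conj, map_zero] at this
    rw [← this]
    refine integral_congr_ae (.of_forall fun x => ?_)
    simp [← Complex.exp_conj]
  have hgc : Integrable (fun x => (starRingEnd ℂ) (g x)) μ := 
    Complex.conjCLE.integrable_comp_iff.2 hg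
  have hre := ae_eq_zero_of_charFun_real (g := fun x => (g x).re) hg.re fun L => by
    calc
      _ = ∫ x, (1 / 2 : ℂ) * (Complex.exp (L x * Complex.I) * g x +
          Complex.exp (L x * Complex.I) * (starRingEnd ℂ) (g x)) ∂μ := by
        refine integral_congr_ae (.of_forall fun x => ?_)
        simp only [Complex.re_eq_add_conj]
        ring
      _ = 0 := by
        rw [integral_const_mul, integral_add (integrable_cexp_dual_mul hg L)
          (integrable_cexp_dual_mul hgc L), h, hconj]
        simp
  have him := ae_eq_zero_of_charFun_real (g := fun x => (g x).im) hg.im fun L => by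
    calc
      _ = ∫ x, (1 / (2 * Complex.I) : ℂ) * (Complex.exp (L x * Complex.I) * g x -
          Complex.exp (L x * Complex.I) * (starRingEnd ℂ) (g x)) ∂μ := by
        refine integral_congr_ae (.of_forall fun x => ?_)
        simp only [Complex.im_eq_sub_conj]
        ring
      _ = 0 := by
        rw [integral_const_mul, integral_sub (integrable_cexp_dual_mul hg L)
          (integrable_cexp_dual_mul hgc L), h, hconj]
        simp
  filter_upwards [hre, him] with x h1 h2
  exact Complex.ext h1 h2

end CharFun

/-! ### Compactly supported functions are determined by their moments -/

section Uniqueness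

variable {Ω V : Type*} [MeasurableSpace Ω] [NormedAddCommGroup V] [InnerProductSpace ℝ V]
  [FiniteDimensional ℝ V] [MeasurableSpace V] [BorelSpace V]

/-- The shear preserves null sets, and Fubini then gives the property along the shifted family for
almost every `y`, although a single such family may itself be a null set. -/
theorem ae_shifted_of_ae (σ : Measure Ω) [SFinite σ] {P : V × ℝ → Prop} (hP : ∀ᵐ x, P x)
    {τ : Ω × ℝ → V} (hτ : Measurable τ) (s : Set ℝ) :
    ∀ᵐ y : V, ∀ᵐ z ∂(σ.prod (volume.restrict s)), P (τ z + y, z.2) := by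
  have h1 : ∀ᵐ x ∂((volume : Measure V).prod (volume.restrict s)), P x :=
    (Measure.prod_mono le_rfl Measure.restrict_le_self).absolutelyContinuous.ae_le hP
  have h2 := Measure.measurePreserving_swap.quasiMeasurePreserving.ae h1
  have h3 := (MeasureTheory.QuasiMeasurePreserving.prodMap (Measure.quasiMeasurePreserving_snd (μ := σ) (ν := volume.restrict s))
    (Measure.QuasiMeasurePreserving.id (volume : Measure V))).ae h2
  have h4 := (measurePreserving_shear (σ.prod (volume.restrict s)) (volume : Measure V)
    hτ).quasiMeasurePreserving.ae h3
  exact Measure.ae_ae_of_ae_prod (Measure.measurePreserving_swap.quasiMeasurePreserving.ae h4)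

theorem integrable_moment_of_ae_eq_zero_off_compact {K : Set (V × ℝ)} (hK : IsCompact K)
    {h : V × ℝ → ℂ} (hh : Integrable h) (hK0 : ∀ᵐ x, x ∉ K → h x = 0) (ξ : V) (j : ℕ) :
    Integrable fun x : V × ℝ => (inner ℝ x.1 ξ) ^ j • h x := by
  have hc : Continuous fun x : V × ℝ => (inner ℝ x.1 ξ) ^ j := by fun_prop
  refine (hh.integrableOn.continuousOn_smul hc.continuousOn hK).integrable_of_ae_notMem_eq_zero ?_
  filter_upwards [hK0] with x hx hxK
  rw [hx hxK, smul_zero]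

/-- A function of bounded support all of whose horizontal moments vanish is zero. -/
theorem ae_eq_zero_of_moment_eq_zero {K : Set (V × ℝ)} (hK : IsCompact K)
    {h : V × ℝ → ℂ} (hh : Integrable h) (hK0 : ∀ᵐ x, x ∉ K → h x = 0)
    (hm : ∀ (ξ : V) (m : ℕ), ∀ᵐ w : ℝ, ∫ x : V, (inner ℝ x ξ) ^ m • h (x, w) = 0) :
    h =ᵐ[volume] 0 := by
  refine ae_eq_zero_of_charFun hh fun L => ?_
  set ξ : V := (InnerProductSpace.toDual ℝ V).symm (L.comp (ContinuousLinearMap.inl ℝ V ℝ)) with hξ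
  set η : ℝ := L (0, 1)
  have hL : ∀ x : V × ℝ, L x = inner ℝ x.1 ξ + x.2 * η := by
    intro x
    have h1 : inner ℝ x.1 ξ = L (x.1, 0) := by
      rw [real_inner_comm, hξ, InnerProductSpace.toDual_symm_apply]
      simp
    have h2 : x = (x.1, 0) + x.2 • ((0 : V), (1 : ℝ)) := by ext <;> simp
    conv_lhs => rw [h2]
    rw [map_add, map_smul, h1, smul_eq_mul]
  -- Terms of the expansion of `exp(i ⟨x, ξ⟩)` in the Fourier integrand. The variable `w` keeps its
  -- exponential, so no moments in `w` are needed.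
  set F : ℕ → V × ℝ → ℂ := fun m x => (Complex.I ^ m / (m.factorial : ℂ)) *
    (Complex.exp ((x.2 * η : ℝ) * Complex.I) * ((inner ℝ x.1 ξ) ^ m • h x)) with hF
  have hint := integrable_moment_of_ae_eq_zero_off_compact hK hh hK0 ξ
  have hexp : Continuous fun x : V × ℝ => Complex.exp ((x.2 * η : ℝ) * Complex.I) := by fun_prop
  have hFi : ∀ m, Integrable (F m) := fun m =>
    ((hint m).bdd_mul (c := 1) hexp.aestronglyMeasurable
      (.of_forall fun x => (Complex.norm_exp_ofReal_mul_I _).le)).const_mul _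
  have hF0 : ∀ m, ∫ x, F m x = 0 := by
    intro m
    have h1 : ∫ x, F m x = ∫ w : ℝ, ∫ y : V, F m (y, w) :=
      integral_prod_symm (F m) (hFi m)
    rw [h1]
    refine integral_eq_zero_of_ae ?_
    filter_upwards [hm ξ m] with w hw
    simp only [hF, integral_const_mul]
    rw [hw]
    simp
  obtain ⟨R, hR⟩ := hK.exists_bound_of_continuousOn
    (f := fun x : V × ℝ => inner ℝ x.1 ξ) (by fun_prop)
  -- On the support `|⟨x, ξ⟩| ≤ |R|`, so the norms are dominated by an exponential series and sum
  -- and integral may be exchanged. The absolute value covers an empty `K`, where `R` may be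
  -- negative.
  have hbound : ∀ m, ∫ x, ‖F m x‖ ≤ (|R| ^ m / m.factorial) * ∫ x, ‖h x‖ := by
    intro m
    rw [← integral_const_mul]
    refine integral_mono_ae (hFi m).norm (hh.norm.const_mul _) ?_
    filter_upwards [hK0] with x hx
    by_cases hxK : x ∈ K
    · simp only [hF, norm_mul, norm_div, norm_pow, Complex.norm_I, one_pow, norm_smul,
        Complex.norm_exp_ofReal_mul_I, one_mul, Complex.norm_natCast]
      have : ‖inner ℝ x.1 ξ‖ ^ m ≤ |R| ^ m := by
        gcongr
        exact (hR x hxK).trans (le_abs_self R)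
      calc _ = ‖inner ℝ x.1 ξ‖ ^ m / m.factorial * ‖h x‖ := by ring
        _ ≤ _ := by gcongr
    · simp [hF, hx hxK]
  have hsum : Summable fun m => ∫ x, ‖F m x‖ :=
    .of_nonneg_of_le (fun m => integral_nonneg fun _ => norm_nonneg _) hbound
      ((Real.summable_pow_div_factorial |R|).mul_right _)
  have htot := hasSum_integral_of_summable_integral_norm hFi hsum
  simp only [hF0] at htot
  rw [← htot.unique hasSum_zero]
  refine integral_congr_ae (.of_forall fun x => ?_)
  have hs : HasSum (fun m => F m x) (Complex.exp (L x * Complex.I) * h x) := by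
    have he : HasSum (fun m : ℕ => ((inner ℝ x.1 ξ : ℝ) * Complex.I) ^ m / (m.factorial : ℂ))
        (Complex.exp ((inner ℝ x.1 ξ : ℝ) * Complex.I)) := by
      rw [Complex.exp_eq_exp_ℂ]
      exact NormedSpace.expSeries_div_hasSum_exp _
    convert! he.mul_right (Complex.exp ((x.2 * η : ℝ) * Complex.I) * h x) using 1
    · ext m
      simp only [hF, Complex.real_smul, Complex.ofReal_pow]
      ring
    · rw [← mul_assoc, ← Complex.exp_add, hL]
      push_cast
      ring_nf
  exact hs.tsum_eq.symm

end Uniqueness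

/-! ### The transform as an average over shifts -/

section Transform

variable {n : ℕ} {a b : ℝ}

theorem MemL2c.integrable {f : Horiz n × ℝ → ℂ} (hf : MemL2c n a b f) : Integrable f := by
  obtain ⟨h2, K, hK, -, h0⟩ := hf
  have : IsFiniteMeasure ((volume : Measure (Horiz n × ℝ)).restrict K) :=
    ⟨by simpa using hK.measure_lt_top⟩
  have h1 : IntegrableOn f K := (h2.restrict K).integrable (by norm_num)
  exact h1.integrable_of_ae_notMem_eq_zero h0

theorem MemL2c.sub {f g : Horiz n × ℝ → ℂ} (hf : MemL2c n a b f) (hg : MemL2c n a b g) :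
    MemL2c n a b (f - g) := by
  obtain ⟨h2, K, hK, hKs, h0⟩ := hf
  obtain ⟨h2', K', hK', hKs', h0'⟩ := hg
  refine ⟨h2.sub h2', K ∪ K', hK.union hK', union_subset hKs hKs', ?_⟩
  filter_upwards [h0, h0'] with x hx hx' hxK
  rw [mem_union, not_or] at hxK
  simp [hx hxK.1, hx' hxK.2]

instance : IsFiniteMeasure (surfaceMeasure n) := by
  unfold surfaceMeasure; infer_instance

theorem surfaceMeasure_ne_zero (hn : 2 ≤ n) : surfaceMeasure n ≠ 0 := by
  have : Nonempty (Fin (n - 1)) := ⟨⟨0, by omega⟩⟩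
  exact Measure.toSphere_ne_zero _

/-- The horizontal displacement `r(p, w) Θ`, cut off outside `a ≤ w ≤ p`. -/
noncomputable def displacement (n : ℕ) (a : ℝ) (r : ℝ → ℝ → ℝ) (p : ℝ) (z : UnitSphere n × ℝ) :
    Horiz n :=
  (Icc a p).indicator (r p) z.2 • (z.1 : Horiz n)

theorem measurable_displacement {r : ℝ → ℝ → ℝ} {p : ℝ} (hr : ContinuousOn (r p) (Icc a p)) :
    Measurable (displacement n a r p) := by
  classical
  have h : Measurable ((Icc a p).indicator (r p)) := by
    rw [← piecewise_eq_indicator]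
    exact hr.measurable_piecewise continuousOn_const measurableSet_Icc
  exact (h.comp measurable_snd).smul (measurable_subtype_coe.comp measurable_fst)

theorem exists_norm_displacement_le {r : ℝ → ℝ → ℝ} {p : ℝ} (hr : ContinuousOn (r p) (Icc a p)) :
    ∃ R, ∀ z, ‖displacement n a r p z‖ ≤ R := by
  obtain ⟨R, hR⟩ := isCompact_Icc.exists_bound_of_continuousOn hr
  refine ⟨|R|, fun z => ?_⟩
  rw [displacement, norm_smul, norm_eq_of_mem_sphere z.1, mul_one]
  by_cases hz : z.2 ∈ Icc a p
  · simpa [hz] using (hR _ hz).trans (le_abs_self R)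
  · simp [hz]

/-- The endpoints `w = a` and `w = p` are discarded as a null set: `r` is arbitrary outside the
triangle, so its derivative is not controlled there. -/
theorem radonIntegrand_ae_eq {r k : ℝ → ℝ → ℝ} {p : ℝ}
    (hk : ∀ w, a < w → w < p →
      Real.sqrt (1 + (deriv (fun t => r p t) w) ^ 2) * r p w ^ (n - 2) = k p w)
    (f : Horiz n × ℝ → ℂ) (y : Horiz n) :
    (fun z : UnitSphere n × ℝ => radonIntegrand n r f p y z.1 z.2)
      =ᵐ[(surfaceMeasure n).prod (volume.restrict (Icc a p))]
      fun z => k p z.2 • f (displacement n a r p z + y, z.2) := by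
  have h : ∀ᵐ w ∂(volume.restrict (Icc a p)), w ∈ Ioo a p := by
    rw [← restrict_Ioo_eq_restrict_Icc]
    exact ae_restrict_mem measurableSet_Ioo
  filter_upwards [Measure.quasiMeasurePreserving_snd.ae h] with z hz
  simp only [radonIntegrand, displacement, hk z.2 hz.1 hz.2, Complex.real_smul,
    indicator_of_mem (Ioo_subset_Icc_self hz)]

end Transform

theorem theorem4p4 (n q : ℕ) (hn : 2 ≤ n) (hq : 1 ≤ q) (a b : ℝ) (ha : 0 ≤ a) (hab : a < b)
    (ν r : ℝ → ℝ → ℝ)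
    (hν : ContDiffOn ℝ ∞ (fun z : ℝ × ℝ => ν z.1 z.2) (triangle a b))
    (hdiag : ∀ p ∈ Icc a b, ν p p ≠ 0)
    (hr : ∀ p w : ℝ, (p, w) ∈ triangle a b → r p w = (p - w) ^ ((q : ℝ) / 2) * ν p w) :
    (∀ f : Horiz n × ℝ → ℂ, MemL2c n a b f →
      ∀ᵐ p ∂(volume.restrict (Icc a b)), ∀ᵐ y : Horiz n,
        Integrable (fun z : UnitSphere n × ℝ => radonIntegrand n r f p y z.1 z.2)
          ((surfaceMeasure n).prod (volume.restrict (Icc a p)))) ∧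
    (∀ f g : Horiz n × ℝ → ℂ, MemL2c n a b f → MemL2c n a b g →
      ((∀ᵐ p ∂(volume.restrict (Icc a b)), ∀ᵐ y : Horiz n,
          genRadon n a r f p y = genRadon n a r g p y) ↔ f =ᵐ[volume] g)) := by
  obtain ⟨β, M, hβ, hM, hMdiag, hk⟩ := exists_weight_factorization n hq hab hν hdiag hr
  set k : ℝ → ℝ → ℝ := fun p w => (p - w) ^ β * M p w with hkdef
  have hrc : ∀ p ∈ Icc a b, ContinuousOn (r p) (Icc a p) := by
    intro p hp
    have h1 : ContinuousOn (fun w => (p - w) ^ ((q : ℝ) / 2) * ν p w) (Icc a p) := by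
      refine ContinuousOn.mul ?_ ?_
      · exact ((continuous_const.sub continuous_id).rpow_const
          fun _ => Or.inr (by positivity)).continuousOn
      · exact hν.continuousOn.comp (f := fun w : ℝ => (p, w)) (by fun_prop)
          fun w hw => ⟨hp.1, hp.2, hw.1, hw.2⟩
    exact h1.congr fun w hw => hr p w ⟨hp.1, hp.2, hw.1, hw.2⟩
  have hτ : ∀ p ∈ Icc a b, Measurable (displacement n a r p) := fun p hp =>
    measurable_displacement (hrc p hp)
  have heq : ∀ p ∈ Icc a b, ∀ (f : Horiz n × ℝ → ℂ) (y : Horiz n),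
      (fun z : UnitSphere n × ℝ => radonIntegrand n r f p y z.1 z.2)
        =ᵐ[(surfaceMeasure n).prod (volume.restrict (Icc a p))]
        fun z => k p z.2 • f (displacement n a r p z + y, z.2) := fun p hp f y =>
    radonIntegrand_ae_eq (fun w h1 h2 => hk p w h1 h2 hp.2) f y
  have hint : ∀ f : Horiz n × ℝ → ℂ, MemL2c n a b f →
      ∀ᵐ p ∂(volume.restrict (Icc a b)), ∀ᵐ y : Horiz n,
        Integrable (fun z : UnitSphere n × ℝ => k p z.2 • f (displacement n a r p z + y, z.2))
          ((surfaceMeasure n).prod (volume.restrict (Icc a p))) := by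
    intro f hf
    filter_upwards [ae_integrable_weight_smul hβ hM.continuousOn hf.integrable,
      ae_restrict_mem measurableSet_Icc] with p hp hpI
    exact ae_integrable_shifted (surfaceMeasure n) (k := k p) hp (hτ p hpI)
  have hradon : ∀ p ∈ Icc a b, ∀ (f : Horiz n × ℝ → ℂ) (y : Horiz n),
      Integrable (fun z : UnitSphere n × ℝ => k p z.2 • f (displacement n a r p z + y, z.2))
          ((surfaceMeasure n).prod (volume.restrict (Icc a p))) →
      genRadon n a r f p y = ∫ z, k p z.2 • f (displacement n a r p z + y, z.2)
        ∂((surfaceMeasure n).prod (volume.restrict (Icc a p))) := by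
    intro p hp f y hi
    rw [← integral_congr_ae (heq p hp f y), integral_prod _ ((integrable_congr (heq p hp f y)).2 hi)]
    rfl
  refine ⟨fun f hf => ?_, fun f g hf hg => ⟨fun h => ?_, fun h => ?_⟩⟩
  · filter_upwards [hint f hf, ae_restrict_mem measurableSet_Icc] with p hp hpI
    filter_upwards [hp] with y hy
    exact (integrable_congr (heq p hpI f y)).2 hy
  · have hd := hf.sub hg
    have hdi := hd.integrable
    obtain ⟨-, K, hK, hKs, hK0⟩ := hd
    have : NeZero (surfaceMeasure n) := ⟨surfaceMeasure_ne_zero hn⟩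
    have hz : ∀ᵐ p ∂(volume.restrict (Icc a b)), ∀ᵐ y : Horiz n,
        ∫ z, k p z.2 • (f - g) (displacement n a r p z + y, z.2)
          ∂((surfaceMeasure n).prod (volume.restrict (Icc a p))) = 0 := by
      filter_upwards [h, hint f hf, hint g hg, ae_restrict_mem measurableSet_Icc] with p h1 h2 h3 hp
      filter_upwards [h1, h2, h3] with y h1 h2 h3
      simp only [Pi.sub_apply, smul_sub]
      rw [integral_sub h2 h3, ← hradon p hp f y h2, ← hradon p hp g y h3, h1, sub_self]
    -- The Abel argument covers only `w ∈ [a, b]`; for other `w` the moments vanish because `K` lies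
    -- in the slab.
    have hout : ∀ᵐ w : ℝ, w ∉ Icc a b → ∀ᵐ x : Horiz n, (f - g) (x, w) = 0 := by
      have h1 := Measure.ae_ae_of_ae_prod
        ((Measure.measurePreserving_swap (μ := (volume : Measure ℝ))
          (ν := (volume : Measure (Horiz n)))).quasiMeasurePreserving.ae hK0)
      filter_upwards [h1] with w hw hwI
      filter_upwards [hw] with x hx
      exact hx fun hxK => hwI (hKs hxK)
    have hzero := ae_eq_zero_of_moment_eq_zero hK hdi hK0 fun ξ m => by
      have hin := ae_moment_eq_zero hab (surfaceMeasure n) hβ hM hMdiag hτ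
        (fun p hp => exists_norm_displacement_le (hrc p hp)) ξ
        (integrable_moment_of_ae_eq_zero_off_compact hK hdi hK0 ξ) hz m
      filter_upwards [(ae_restrict_iff' measurableSet_Icc).1 hin, hout] with w h1 h2
      by_cases hw : w ∈ Icc a b
      · exact h1 hw
      · refine integral_eq_zero_of_ae ?_
        filter_upwards [h2 hw] with x hx
        rw [hx, smul_zero]
        rfl
    filter_upwards [hzero] with x hx
    exact sub_eq_zero.1 hx
  · filter_upwards [hint f hf, hint g hg, ae_restrict_mem measurableSet_Icc] with p h2 h3 hp
    filter_upwards [h2, h3, ae_shifted_of_ae (surfaceMeasure n) h (hτ p hp) (Icc a p)] with y h2 h3 h4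
    rw [hradon p hp f y h2, hradon p hp g y h3]
    refine integral_congr_ae ?_
    filter_upwards [h4] with z hz
    rw [hz]
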